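/- Let $d\ge 1$ and let $\mathcal S_{\mathrm{even}},\mathcal S_{\mathrm{odd}}\subset\mathbb R^d$ and finite sets $V_{\mathrm{odd}},V_{\mathrm{even}}\subset\mathbb R^d$ satisfy: $x+v\in\mathcal S_{\mathrm{odd}}$ for $x\in\mathcal S_{\mathrm{even}}$, $v\in V_{\mathrm{odd}}$; $x+v\in\mathcal S_{\mathrm{even}}$ for $x\in\mathcal S_{\mathrm{odd}}$, $v\in V_{\mathrm{even}}$; $V_{\mathrm{odd}}=-V_{\mathrm{even}}$; $0\in\mathcal S_{\mathrm{even}}$; $V_{\mathrm{odd}}\cap V_{\mathrm{even}}=\emptyset$; and $m:=\sharp V_{\mathrm{odd}}=\sharp V_{\mathrm{even}}\ge 2$. Put $V=V_{\mathrm{odd}}\cup V_{\mathrm{even}}$, and $V_k=V_{\mathrm{odd}}$ for odd $k$, $V_k=V_{\mathrm{even}}$ for even $k$. Let $p,q\in[0,1]$ and $$\alpha=\frac{mp-1}{m-1},\qquad \beta=\frac{mq-1}{m-1},\qquad \delta=\frac{\alpha-\beta}{2}.$$ On a probability space let $X_1$ be uniformly distributed on $V_{\mathrm{odd}}$, let $\mathcal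 U_n$ $(n\ge1)$ be uniformly distributed on $\{1,\dots,n\}$, and let $G_k(v)$ $(k\ge2,\ v\in V)$ be $V_k$-valued random variables such that, for $w\in V_k$, $$\mathbb P(G_k(v)=w)=\begin{cases}p & \text{if } v\in V_k,\ w=v,\\ \frac{1-p}{m-1} & \text{if } v\in V_k,\ w\ne v,\\ q & \text{if } v\notin V_k,\ w=-v,\\ \frac{1-q}{m-1} & \text{if } v\notin V_k,\ w\neq -v.\end{cases}$$ Assume that the $\sigma$-fields $\sigma(X_1)$, $\sigma(\mathcal U_1,\{G_2(v)\}_{v\in V})$, $\sigma(\mathcal U_2,\{G_3(v)\}_{v\in V}),\dots$ are independent and that, for all $n\ge 1$ and $v\in V$, $\mathcal U_n$ is independent of $G_{n+1}(v)$. The elephant random walk $\{S_n\}_{n\ge0}$ is defined by $$X_{n+1}=G_{n+1}(X_{\mathcal U_n})\quad(n\ge1),\qquad S_0=0,\qquad S_{n+1}=S_n+X_{n+1}\quad(n\ge0).$$ Assume that $\delta=\tfrac12$. Then, for every $\eta>0$, almost surely $$|S_n|=o\!\left(\sqrt{n\,(\log n)\,(\log\log n)^{1+\eta}}\right)\qquad\text{as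 } n\to\infty,$$ where $|\cdot|$ is the Euclidean norm on $\mathbb R^d$. -/

import Mathlib

open MeasureTheory ProbabilityTheory

/-- The geometric data of the walk in `ℝ^d`: two sets of sites and two finite sets of step
directions. From an even site one moves in a direction of `Vodd` (at odd times) to an odd site,
from an odd site in a direction of `Veven` (at even times) to an even site. -/
structure StepSystem (d : ℕ) where
  Seven : Set (EuclideanSpace ℝ (Fin d))
  Sodd : Set (EuclideanSpace ℝ (Fin d))
  Vodd : Finset (EuclideanSpace ℝ (Fin d))
  Veven : Finset (EuclideanSpace ℝ (Fin d))
  add_mem_Sodd : ∀ x ∈ Seven, ∀ v ∈ Vodd, x + v ∈ Sodd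
  add_mem_Seven : ∀ x ∈ Sodd, ∀ v ∈ Veven, x + v ∈ Seven
  mem_Vodd_iff : ∀ v, v ∈ Vodd ↔ -v ∈ Veven
  zero_mem_Seven : 0 ∈ Seven
  disjoint_dirs : Disjoint Vodd Veven
  two_le_card : 2 ≤ Vodd.card

namespace StepSystem

variable {d : ℕ}

/-- The number `m` of admissible directions at each site. -/
def m (L : StepSystem d) : ℕ := L.Vodd.card

/-- The admissible directions for the step taken at time `k`. -/
noncomputable def dirs (L : StepSystem d) (k : ℕ) : Finset (EuclideanSpace ℝ (Fin d)) :=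
  if Odd k then L.Vodd else L.Veven

/-- All directions, `V = Vodd ∪ Veven`. -/
def V (L : StepSystem d) : Set (EuclideanSpace ℝ (Fin d)) :=
  {v | v ∈ L.Vodd ∨ v ∈ L.Veven}

/-- `α = (m p - 1) / (m - 1)`. -/
noncomputable def alpha (L : StepSystem d) (p : ℝ) : ℝ := (L.m * p - 1) / (L.m - 1)

/-- `β = (m q - 1) / (m - 1)`. -/
noncomputable def beta (L : StepSystem d) (q : ℝ) : ℝ := (L.m * q - 1) / (L.m - 1)

/-- `δ = (α - β) / 2`. -/
noncomputable def delta (L : StepSystem d) (p q : ℝ) : ℝ := (L.alpha p - L.beta q) / 2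

open Classical in
/-- The probability that the elephant which recalls the direction `v ∈ V` makes the step
`w ∈ dirs k` at time `k`. If `v` is itself admissible at time `k`, it is repeated with
probability `p`; otherwise `-v` is admissible and is chosen with probability `q`. The remaining
mass is spread evenly over the other `m - 1` admissible directions. -/
noncomputable def stepProb (L : StepSystem d) (p q : ℝ) (k : ℕ)
    (v w : EuclideanSpace ℝ (Fin d)) : ℝ :=
  if v ∈ L.dirs k then
    if w = v then p else (1 - p) / (L.m - 1)
  else
    if w = -v then q else (1 - q) / (L.m - 1)

end StepSystem

/-- The `σ`-algebras `σ(X₁), σ(U₁, (G₂(v))_{v ∈ V}), σ(U₂, (G₃(v))_{v ∈ V}), …`, numbered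
from `0`. -/
@[reducible]
def inputSigma {d : ℕ} {Ω : Type*} (L : StepSystem d)
    (X₁ : Ω → EuclideanSpace ℝ (Fin d)) (U : ℕ → Ω → ℕ)
    (G : ℕ → EuclideanSpace ℝ (Fin d) → Ω → EuclideanSpace ℝ (Fin d)) :
    ℕ → MeasurableSpace Ω
  | 0 => MeasurableSpace.comap X₁ inferInstance
  | n + 1 => MeasurableSpace.comap (U (n + 1)) ⊤ ⊔
      ⨆ v ∈ L.V, MeasurableSpace.comap (G (n + 2) v) inferInstance

/-- The random inputs of the elephant random walk with memory parameters `p, q`: the first step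
`X₁`, the recalled times `U n` (`n ≥ 1`) and the responses `G k v` (`k ≥ 2`, `v ∈ V`).
Only the marginal law of each `G k v` is prescribed, not the joint law over `v`. -/
structure IsERWInput {d : ℕ} {Ω : Type*} [MeasurableSpace Ω] (L : StepSystem d) (p q : ℝ)
    (μ : Measure Ω) (X₁ : Ω → EuclideanSpace ℝ (Fin d)) (U : ℕ → Ω → ℕ)
    (G : ℕ → EuclideanSpace ℝ (Fin d) → Ω → EuclideanSpace ℝ (Fin d)) : Prop where
  measurable_first : Measurable X₁
  first_mem : ∀ ω, X₁ ω ∈ L.Vodd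
  first_law : ∀ v ∈ L.Vodd, μ.real {ω | X₁ ω = v} = 1 / (L.m : ℝ)
  measurable_time : ∀ n, 1 ≤ n → Measurable (U n)
  time_mem : ∀ n, 1 ≤ n → ∀ ω, U n ω ∈ Finset.Icc 1 n
  time_law : ∀ n, 1 ≤ n → ∀ k ∈ Finset.Icc 1 n, μ.real {ω | U n ω = k} = 1 / (n : ℝ)
  measurable_response : ∀ k, 2 ≤ k → ∀ v ∈ L.V, Measurable (G k v)
  response_mem : ∀ k, 2 ≤ k → ∀ v ∈ L.V, ∀ ω, G k v ω ∈ L.dirs k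
  response_law : ∀ k, 2 ≤ k → ∀ v ∈ L.V, ∀ w ∈ L.dirs k,
    μ.real {ω | G k v ω = w} = L.stepProb p q k v w
  indep_time_response : ∀ n, 1 ≤ n → ∀ v ∈ L.V, IndepFun (U n) (G (n + 1) v) μ
  indep : iIndep (inputSigma L X₁ U G) μ

/-- The steps of the elephant: `X 1 = X₁` and `X (n + 1) = G (n + 1) (X (U n))` for `n ≥ 1`.
The value `X 0 = 0` and the last branch (never taken when `U n ∈ {1, …, n}`) are fillers. -/
def erwStep {d : ℕ} {Ω : Type*} (X₁ : Ω → EuclideanSpace ℝ (Fin d)) (U : ℕ → Ω → ℕ)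
    (G : ℕ → EuclideanSpace ℝ (Fin d) → Ω → EuclideanSpace ℝ (Fin d)) (n : ℕ) (ω : Ω) :
    EuclideanSpace ℝ (Fin d) :=
  match n with
  | 0 => 0
  | 1 => X₁ ω
  | n + 2 =>
    if _h : U (n + 1) ω ≤ n + 1 then G (n + 2) (erwStep X₁ U G (U (n + 1) ω) ω) ω else 0
termination_by n
decreasing_by omega

/-- The position of the elephant: `S 0 = 0`, `S (n + 1) = S n + X (n + 1)`. -/
def erwPos {d : ℕ} {Ω : Type*} (X₁ : Ω → EuclideanSpace ℝ (Fin d)) (U : ℕ → Ω → ℕ)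
    (G : ℕ → EuclideanSpace ℝ (Fin d) → Ω → EuclideanSpace ℝ (Fin d)) :
    ℕ → Ω → EuclideanSpace ℝ (Fin d)
  | 0, _ => 0
  | n + 1, ω => erwPos X₁ U G n ω + erwStep X₁ U G (n + 1) ω

theorem erwStep_one {d : ℕ} {Ω : Type*} (X₁ : Ω → EuclideanSpace ℝ (Fin d)) (U : ℕ → Ω → ℕ)
    (G : ℕ → EuclideanSpace ℝ (Fin d) → Ω → EuclideanSpace ℝ (Fin d)) (ω : Ω) :
    erwStep X₁ U G 1 ω = X₁ ω := by
  rw [erwStep]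

/-- The defining recursion of the steps holds for all `n ≥ 1`. -/
theorem IsERWInput.erwStep_succ {d : ℕ} {Ω : Type*} [MeasurableSpace Ω] {L : StepSystem d}
    {p q : ℝ} {μ : Measure Ω} {X₁ : Ω → EuclideanSpace ℝ (Fin d)} {U : ℕ → Ω → ℕ}
    {G : ℕ → EuclideanSpace ℝ (Fin d) → Ω → EuclideanSpace ℝ (Fin d)}
    (h : IsERWInput L p q μ X₁ U G) (n : ℕ) (hn : 1 ≤ n) (ω : Ω) :
    erwStep X₁ U G (n + 1) ω = G (n + 1) (erwStep X₁ U G (U n ω) ω) ω := by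
  obtain ⟨k, rfl⟩ : ∃ k, n = k + 1 := ⟨n - 1, by omega⟩
  have := (Finset.mem_Icc.mp (h.time_mem (k + 1) hn ω)).2
  rw [erwStep, dif_pos this]

/-! Fix a coordinate and let `z k` be that coordinate of the step at time `k + 1`, minus `(-1) ^ k`
times the barycentre of `Vodd`. Averaging the response over the uniform recalled time shows that,
given the past, `z n` has mean `(S / 2 + ε (-1) ^ n T) / n`. Here `S` and `T` are the plain and the
alternating sum of `z 0, …, z (n - 1)`, `ε = (α + β) / 2`, and the coefficient `1 / 2` is `δ`. The
difference `innovation` is therefore a bounded martingale difference (`condExp_innovation`).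

The alternating drift does not accumulate: adding the bounded quantity `ε (-1) ^ n T / (2 n)` to `S`
cancels it up to `O(1 / n)` (`exists_recursion_remainder`). What is left is a recursion with factor
`1 + 1 / (2 n)`, whose homogeneous solutions grow like `√n`. Hence `S / √n` is, up to a bounded
error, the sum of the innovations weighted by `1 / √k` (`exists_abs_sum_le_sqrt_mul`).

The weights `1 / (√k · logScale η k)` are square-summable, because `∑ 1 / (k log k (log log k) ^ (1
+ η))` converges. The correspondingly weighted martingale is bounded in `L²` and converges almost
surely (`ae_exists_tendsto_sum_mul`), and Kronecker's lemma turns this into `o(logScale η n)` for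
the weights `1 / √k`. The barycentre terms cancel in pairs, so the same order holds for the
position. -/

/-! ### Deterministic estimates on sums and square roots. -/

/-- Kronecker's lemma. -/
theorem isLittleO_sum_mul_of_tendsto_sum {b w : ℕ → ℝ} {l : ℝ} (hb : Monotone b)
    (hb' : Filter.Tendsto b Filter.atTop Filter.atTop)
    (hw : Filter.Tendsto (fun n => ∑ k ∈ Finset.range n, w k) Filter.atTop (nhds l)) :
    (fun n => ∑ k ∈ Finset.range n, b k * w k) =o[Filter.atTop] b := by
  set v : ℕ → ℝ := fun n => ∑ k ∈ Finset.range n, w k - l with hv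
  have hv0 : Filter.Tendsto v Filter.atTop (nhds 0) := by
    simpa [hv] using hw.sub_const l
  -- Abel summation against the centred partial sums `v`, which tend to zero.
  have key : ∀ n, ∑ k ∈ Finset.range n, b k * w k =
      b n * v n - b 0 * v 0 - ∑ k ∈ Finset.range n, (b (k + 1) - b k) * v (k + 1) := by
    intro n
    induction n with
    | zero => simp
    | succ n ih =>
      have h1 : v (n + 1) = v n + w n := by simp only [hv, Finset.sum_range_succ]; ring
      rw [Finset.sum_range_succ, Finset.sum_range_succ, ih, h1]; ring
  have hsum : ∀ n, ∑ k ∈ Finset.range n, (b (k + 1) - b k) = b n - b 0 := fun n =>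
    Finset.sum_range_sub b n
  have hconst : ∀ a : ℝ, (fun _ : ℕ => a) =o[Filter.atTop] b := fun a =>
    Asymptotics.isLittleO_const_left.2 (Or.inr (Filter.tendsto_abs_atTop_atTop.comp hb'))
  have h1 : (fun n => b n * v n) =o[Filter.atTop] b := by
    have := (Asymptotics.isBigO_refl b Filter.atTop).mul_isLittleO
      ((Asymptotics.isLittleO_one_iff ℝ).2 hv0)
    simpa using this
  have h2 : (fun n => ∑ k ∈ Finset.range n, (b (k + 1) - b k) * v (k + 1)) =o[Filter.atTop]
      fun n => ∑ k ∈ Finset.range n, (b (k + 1) - b k) := by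
    refine Asymptotics.IsLittleO.sum_range ?_ (fun n => sub_nonneg.2 (hb n.le_succ)) ?_
    · have := (Asymptotics.isBigO_refl (fun k => b (k + 1) - b k) Filter.atTop).mul_isLittleO
        ((Asymptotics.isLittleO_one_iff ℝ).2 (hv0.comp (Filter.tendsto_add_atTop_nat 1)))
      simpa using this
    · simp only [hsum]
      exact Filter.tendsto_atTop_add_const_right _ _ hb'
  simp only [hsum] at h2
  have h3 := h2.trans_isBigO ((Asymptotics.isBigO_refl b Filter.atTop).sub (hconst (b 0)).isBigO)
  simpa only [key] using (h1.sub (hconst (b 0 * v 0))).sub h3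

/-- A sequence whose increments agree with those of another one up to a summable error stays
within bounded distance of it. -/
theorem exists_abs_sub_sum_le {N x e : ℕ → ℝ} (he : Summable e)
    (h : ∀ n, |N (n + 1) - N n - x n| ≤ e n) :
    ∃ C, ∀ n, |N n - ∑ k ∈ Finset.range n, x k| ≤ C := by
  refine ⟨|N 0| + ∑' k, e k, fun n => ?_⟩
  have he0 : ∀ n, 0 ≤ e n := fun n => (abs_nonneg _).trans (h n)
  have : |N n - ∑ k ∈ Finset.range n, x k| ≤ |N 0| + ∑ k ∈ Finset.range n, e k := by
    induction n with
    | zero => simp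
    | succ n ih =>
      rw [Finset.sum_range_succ, Finset.sum_range_succ]
      have := abs_add_le (N n - ∑ k ∈ Finset.range n, x k) (N (n + 1) - N n - x n)
      rw [show N n - ∑ k ∈ Finset.range n, x k + (N (n + 1) - N n - x n) =
        N (n + 1) - (∑ k ∈ Finset.range n, x k + x n) by ring] at this
      linarith [h n]
  linarith [he.sum_le_tsum (Finset.range n) fun i _ => he0 i]

theorem abs_sum_range_le {z : ℕ → ℝ} {K : ℝ} (hz : ∀ n, |z n| ≤ K) (n : ℕ) :
    |∑ k ∈ Finset.range n, z k| ≤ K * n := by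
  calc |∑ k ∈ Finset.range n, z k| ≤ ∑ k ∈ Finset.range n, |z k| :=
        Finset.abs_sum_le_sum_abs _ _
    _ ≤ ∑ k ∈ Finset.range n, K := Finset.sum_le_sum fun k _ => hz k
    _ = K * n := by simp [mul_comm]

/-- The squares of `(1 + 1 / (2 x)) √x` and `√(x + 1)` differ only by `1 / (4 x)`, so rationalizing
gives order `x ^ (-5/2)`. Thus the weights `1 / √n` almost cancel the factor `1 + 1 / (2 n)` of the
recursion. -/
theorem abs_one_add_div_sqrt_succ_sub_le {x : ℝ} (hx : 1 ≤ x) :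
    |(1 + 1 / (2 * x)) / √(x + 1) - 1 / √x| ≤ 1 / (x * (x * √x)) := by
  have h0 : 0 < x := by linarith
  set s := √x with hs
  set t := √(x + 1) with ht
  have hs2 : s ^ 2 = x := Real.sq_sqrt h0.le
  have ht2 : t ^ 2 = x + 1 := Real.sq_sqrt (by linarith)
  have hs0 : 0 < s := Real.sqrt_pos.2 h0
  have ht0 : 0 < t := Real.sqrt_pos.2 (by linarith)
  have hst : s ≤ t := Real.sqrt_le_sqrt (by linarith)
  have e1 : ((1 + 1 / (2 * x)) * s - t) * ((1 + 1 / (2 * x)) * s + t) = 1 / (4 * x) := by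
    have : ((1 + 1 / (2 * x)) * s - t) * ((1 + 1 / (2 * x)) * s + t) =
      (1 + 1 / (2 * x)) ^ 2 * s ^ 2 - t ^ 2 := by ring
    rw [this, hs2, ht2]; field_simp; ring
  have hpos : 0 < (1 + 1 / (2 * x)) * s + t := by positivity
  have e2 : (1 + 1 / (2 * x)) / t - 1 / s =
      1 / (4 * x) / ((1 + 1 / (2 * x)) * s + t) / (t * s) := by
    rw [← e1]; field_simp
  rw [e2, abs_of_nonneg (by positivity), div_div, div_div]
  apply one_div_le_one_div_of_le (by positivity)
  have : s ≤ (1 + 1 / (2 * x)) * s + t := by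
    have : 0 ≤ 1 / (2 * x) * s := by positivity
    nlinarith
  have h4 : s * (s * s) ≤ ((1 + 1 / (2 * x)) * s + t) * (t * s) := by gcongr
  have h5 : x * (x * s) = x * (s * (s * s)) := by rw [← hs2]; ring
  rw [h5]
  have h6 : x * (s * (s * s)) ≤ x * (((1 + 1 / (2 * x)) * s + t) * (t * s)) := by gcongr
  have h7 : 0 ≤ x * (((1 + 1 / (2 * x)) * s + t) * (t * s)) := by positivity
  linarith

theorem summable_one_div_succ_mul_sqrt_succ :
    Summable fun n : ℕ => 1 / (((n : ℝ) + 1) * √((n : ℝ) + 1)) := by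
  have h := (Real.summable_one_div_nat_rpow (p := 3 / 2)).2 (by norm_num)
  refine ((summable_nat_add_iff 1).2 h).congr fun n => ?_
  push_cast
  have h0 : (0 : ℝ) < (n : ℝ) + 1 := by positivity
  rw [show (3 / 2 : ℝ) = 1 + 1 / 2 by norm_num, Real.rpow_add h0, Real.rpow_one,
    Real.sqrt_eq_rpow]

/-! ### The critical recursion, pathwise. -/

/-- The innovation of the critical recursion with a sign-alternating memory. -/
noncomputable def innovation (ε : ℝ) (z : ℕ → ℝ) (n : ℕ) : ℝ :=
  z n - ((∑ k ∈ Finset.range n, z k) / 2 +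
    ε * (-1) ^ n * ∑ k ∈ Finset.range n, (-1) ^ k * z k) / n

theorem abs_innovation_le {ε K : ℝ} {z : ℕ → ℝ} (hz : ∀ n, |z n| ≤ K) (n : ℕ) :
    |innovation ε z n| ≤ (2 + |ε|) * K := by
  have hK : 0 ≤ K := (abs_nonneg _).trans (hz 0)
  have hz' : ∀ n, |(-1) ^ n * z n| ≤ K := fun n => by simpa [abs_mul] using hz n
  have hS := abs_sum_range_le hz n
  have hT := abs_sum_range_le hz' n
  -- At `n = 0` the drift is a division by zero, hence `0`, and the innovation is `z 0`.
  rcases Nat.eq_zero_or_pos n with rfl | hn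
  · simp only [innovation, CharP.cast_eq_zero, div_zero, sub_zero]
    nlinarith [hz 0, abs_nonneg ε, mul_nonneg (abs_nonneg ε) hK]
  have hn' : (0 : ℝ) < n := by exact_mod_cast hn
  unfold innovation
  set S := ∑ k ∈ Finset.range n, z k
  set T := ∑ k ∈ Finset.range n, (-1) ^ k * z k
  have h1 : |(S / 2 + ε * (-1) ^ n * T) / n| ≤ (1 + |ε|) * K := by
    rw [abs_div, abs_of_pos hn', div_le_iff₀ hn']
    have h2 : |ε * (-1) ^ n * T| ≤ |ε| * (K * n) := by
      rw [abs_mul, abs_mul, abs_pow, abs_neg, abs_one, one_pow, mul_one]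
      gcongr
    have h3 : |S / 2| ≤ K * n := by
      rw [abs_div, abs_two]; linarith [abs_nonneg S]
    linarith [abs_add_le (S / 2) (ε * (-1) ^ n * T)]
  linarith [abs_sub (z n) ((S / 2 + ε * (-1) ^ n * T) / n), hz n]

/-- `R` is the partial sum plus half the alternating drift. That drift changes sign at each step and
otherwise varies by `O(1 / n)`, so the increment of its half is minus the drift up to `O(1 / n)`,
which removes it from the recursion. -/
theorem exists_recursion_remainder {ε K : ℝ} {z : ℕ → ℝ} (hz : ∀ n, |z n| ≤ K) :
    ∃ (R : ℕ → ℝ) (C : ℝ), 0 ≤ C ∧ (∀ n, |R n| ≤ C * (n + 1)) ∧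
      (∀ n, |R n - ∑ k ∈ Finset.range (n + 1), z k| ≤ C) ∧
      ∀ n : ℕ, |R (n + 1) - (1 + 1 / (2 * ((n : ℝ) + 1))) * R n - innovation ε z (n + 1)| ≤
        C / (n + 1) := by
  have hK : 0 ≤ K := (abs_nonneg _).trans (hz 0)
  set S : ℕ → ℝ := fun n => ∑ k ∈ Finset.range n, z k with hSdef
  set T : ℕ → ℝ := fun n => ∑ k ∈ Finset.range n, (-1) ^ k * z k with hTdef
  have hz' : ∀ n, |(-1) ^ n * z n| ≤ K := fun n => by simpa [abs_mul] using hz n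
  have hS : ∀ n, |S n| ≤ K * n := abs_sum_range_le hz
  have hT : ∀ n, |T n| ≤ K * n := abs_sum_range_le hz'
  have hS1 : ∀ n, S (n + 1) = S n + z n := fun n => Finset.sum_range_succ _ _
  have hT1 : ∀ n, T (n + 1) = T n + (-1) ^ n * z n := fun n => Finset.sum_range_succ _ _
  have habs : ∀ n (a : ℝ), |(-1) ^ n * a| = |a| := fun n a => by simp [abs_mul]
  have hεK : 0 ≤ |ε| * K := by positivity
  have hTn : ∀ n : ℕ, |ε / 2 * ((-1) ^ (n + 1) * (T (n + 1) / ((n : ℝ) + 1)))| ≤ |ε| * K := by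
    intro n
    have h0 : (0 : ℝ) < (n : ℝ) + 1 := by positivity
    have : |T (n + 1) / ((n : ℝ) + 1)| ≤ K := by
      rw [abs_div, abs_of_pos h0, div_le_iff₀ h0]; exact_mod_cast hT (n + 1)
    rw [abs_mul, habs, abs_div, abs_two]
    nlinarith [mul_le_mul_of_nonneg_left this (abs_nonneg ε),
      mul_nonneg (abs_nonneg ε) (abs_nonneg (T (n + 1) / ((n : ℝ) + 1)))]
  -- The summand `K` serves the linear growth bound on `R`; `3 * (|ε| * K)` bounds the three error
  -- terms left in `e1`.
  refine ⟨fun n => S (n + 1) + ε / 2 * ((-1) ^ (n + 1) * (T (n + 1) / ((n : ℝ) + 1))),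
    K + 3 * (|ε| * K), by positivity, fun n => ?_, fun n => ?_, fun n => ?_⟩
  · have h1 := hS (n + 1)
    push_cast at h1
    have h2 := abs_add_le (S (n + 1)) (ε / 2 * ((-1) ^ (n + 1) * (T (n + 1) / ((n : ℝ) + 1))))
    have h3 : (0 : ℝ) ≤ n := by positivity
    nlinarith [hTn n, mul_nonneg hεK h3]
  · simp only [hSdef, add_sub_cancel_left]
    linarith [hTn n]
  · have h0 : (0 : ℝ) < (n : ℝ) + 1 := by positivity
    have h1 : (0 : ℝ) < (n : ℝ) + 1 + 1 := by positivity
    set N : ℝ := (n : ℝ) + 1 with hN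
    have hsq : ((-1 : ℝ) ^ (n + 1)) * (-1) ^ (n + 1) = 1 := by
      rw [← pow_add, ← two_mul, pow_mul]; simp
    have e1 : S (n + 1 + 1) + ε / 2 * ((-1) ^ (n + 1 + 1) * (T (n + 1 + 1) / (((n + 1 : ℕ) : ℝ) + 1)))
        - (1 + 1 / (2 * N)) * (S (n + 1) + ε / 2 * ((-1) ^ (n + 1) * (T (n + 1) / N)))
        - innovation ε z (n + 1) =
        (-(ε / 2 * z (n + 1)) + ε / 2 * ((-1) ^ (n + 1) * (T (n + 1) / N))) / (N + 1)
        - (ε / 2 * ((-1) ^ (n + 1) * (T (n + 1) / N))) / (2 * N) := by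
      have hi : innovation ε z (n + 1) = z (n + 1) - (S (n + 1) / 2 +
        ε * (-1) ^ (n + 1) * T (n + 1)) / N := by simp [innovation, hSdef, hTdef, hN]
      rw [hi, hS1 (n + 1), hT1 (n + 1), pow_succ (-1 : ℝ) (n + 1)]
      push_cast
      rw [← hN]
      set s : ℝ := (-1) ^ (n + 1)
      have hzz : s * -1 * ((T (n + 1) + s * z (n + 1)) / (N + 1)) =
        -(s * T (n + 1) + z (n + 1)) / (N + 1) := by
        have : s * (T (n + 1) + s * z (n + 1)) = s * T (n + 1) + s * s * z (n + 1) := by ring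
        rw [mul_assoc, neg_one_mul, mul_neg, ← mul_div_assoc, this, hsq]; ring
      rw [hzz]
      field_simp
      ring
    rw [e1]
    have hz1 : |ε / 2 * z (n + 1)| ≤ |ε| * K := by
      rw [abs_mul, abs_div, abs_two]
      nlinarith [mul_le_mul_of_nonneg_left (hz (n + 1)) (abs_nonneg ε),
        mul_nonneg (abs_nonneg ε) (abs_nonneg (z (n + 1)))]
    have hQ := hTn n
    set Q := ε / 2 * ((-1) ^ (n + 1) * (T (n + 1) / N))
    have h2 : |(-(ε / 2 * z (n + 1)) + Q) / (N + 1)| ≤ 2 * (|ε| * K) / N := by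
      rw [abs_div, abs_of_pos h1]
      gcongr
      · have := abs_add_le (-(ε / 2 * z (n + 1))) Q
        rw [abs_neg] at this
        linarith
      · linarith
    have h3 : |Q / (2 * N)| ≤ |ε| * K / N := by
      rw [abs_div, abs_of_pos (by positivity : 0 < 2 * N)]
      gcongr
      linarith
    have h4 : 0 ≤ K / N := by positivity
    have h5 : (K + 3 * (|ε| * K)) / N = K / N + 2 * (|ε| * K) / N + |ε| * K / N := by ring
    linarith [abs_sub ((-(ε / 2 * z (n + 1)) + Q) / (N + 1)) (Q / (2 * N))]

/-- Up to a bounded error, the normalized partial sums are the weighted sums of innovations. -/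
theorem exists_abs_sum_le_sqrt_mul {ε K : ℝ} {z : ℕ → ℝ} (hz : ∀ n, |z n| ≤ K) :
    ∃ C, ∀ n : ℕ, |∑ k ∈ Finset.range (n + 1), z k| ≤ √((n : ℝ) + 1) *
      (|∑ k ∈ Finset.range n, innovation ε z (k + 1) / √((k : ℝ) + 2)| + C) := by
  obtain ⟨R, C, hC, hR, hRS, hrec⟩ := exists_recursion_remainder (ε := ε) hz
  obtain ⟨D, hD⟩ := exists_abs_sub_sum_le (N := fun n => R n / √((n : ℝ) + 1))
    (x := fun k => innovation ε z (k + 1) / √((k : ℝ) + 2))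
    -- One `C` comes from the error of the recursion, the other from the mismatch of the weights
    -- times `|R n| ≤ C * (n + 1)`.
    (summable_one_div_succ_mul_sqrt_succ.mul_left (C + C)) (by
      intro n
      have h0 : (1 : ℝ) ≤ (n : ℝ) + 1 := by linarith [(Nat.cast_nonneg n : (0 : ℝ) ≤ n)]
      have hs := abs_one_add_div_sqrt_succ_sub_le h0
      have hr := hrec n
      have hRn := hR n
      push_cast
      set N : ℝ := (n : ℝ) + 1 with hN
      have hN0 : 0 < N := by linarith
      rw [show (n : ℝ) + 2 = N + 1 by rw [hN]; ring]
      have hst : √N ≤ √(N + 1) := Real.sqrt_le_sqrt (by linarith)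
      have hsp : 0 < √N := Real.sqrt_pos.2 hN0
      have e : R (n + 1) / √(N + 1) - R n / √N - innovation ε z (n + 1) / √(N + 1) =
          (R (n + 1) - (1 + 1 / (2 * N)) * R n - innovation ε z (n + 1)) / √(N + 1) +
          ((1 + 1 / (2 * N)) / √(N + 1) - 1 / √N) * R n := by ring
      rw [e]
      have h1 : |(R (n + 1) - (1 + 1 / (2 * N)) * R n - innovation ε z (n + 1)) / √(N + 1)| ≤
          C * (1 / (N * √N)) := by
        rw [abs_div, abs_of_pos (hsp.trans_le hst), mul_one_div, ← div_div C]
        exact div_le_div₀ (by positivity) hr hsp hst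
      have h2 : |((1 + 1 / (2 * N)) / √(N + 1) - 1 / √N) * R n| ≤ C * (1 / (N * √N)) := by
        rw [abs_mul]
        calc _ ≤ 1 / (N * (N * √N)) * (C * N) := by gcongr
          _ = C * (1 / (N * √N)) := by field_simp
      linarith [abs_add_le ((R (n + 1) - (1 + 1 / (2 * N)) * R n - innovation ε z (n + 1)) /
        √(N + 1)) (((1 + 1 / (2 * N)) / √(N + 1) - 1 / √N) * R n)])
  refine ⟨D + C, fun n => ?_⟩
  set M := ∑ k ∈ Finset.range n, innovation ε z (k + 1) / √((k : ℝ) + 2)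
  have hDn : |R n / √((n : ℝ) + 1) - M| ≤ D := hD n
  have hRSn := hRS n
  have h1 : (1 : ℝ) ≤ √((n : ℝ) + 1) := Real.one_le_sqrt.2 (by
    linarith [(Nat.cast_nonneg n : (0 : ℝ) ≤ n)])
  set s := √((n : ℝ) + 1)
  have h2 : |R n / s| ≤ |M| + D := by
    linarith [abs_sub_abs_le_abs_sub (R n / s) M]
  rw [abs_div, abs_of_pos (by linarith : 0 < s), div_le_iff₀ (by linarith)] at h2
  have h3 := abs_sub_abs_le_abs_sub (∑ k ∈ Finset.range (n + 1), z k) (R n)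
  rw [abs_sub_comm] at h3
  nlinarith [mul_le_mul_of_nonneg_right h1 hC]

/-! ### The normalizing sequence. -/

/-- The normalizing sequence `√(log n (log log n)^(1+η))`, made monotone at small `n`. -/
noncomputable def logScale (η : ℝ) (n : ℕ) : ℝ :=
  √(Real.log (max n 16 : ℕ) * Real.log (Real.log (max n 16 : ℕ)) ^ (1 + η))

theorem one_lt_log_of_sixteen_le {x : ℝ} (hx : 16 ≤ x) : 1 < Real.log x := by
  rw [Real.lt_log_iff_exp_lt (by linarith)]
  linarith [Real.exp_one_lt_d9]

theorem logScale_pos {η : ℝ} (n : ℕ) : 0 < logScale η n := by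
  have h : (16 : ℝ) ≤ (max n 16 : ℕ) := by exact_mod_cast le_max_right n 16
  have h1 := one_lt_log_of_sixteen_le h
  have h2 := Real.log_pos h1
  unfold logScale
  positivity

theorem logScale_monotone {η : ℝ} (hη : 0 < η) : Monotone (logScale η) := by
  intro a b hab
  have ha : (16 : ℝ) ≤ (max a 16 : ℕ) := by exact_mod_cast le_max_right a 16
  have hm : ((max a 16 : ℕ) : ℝ) ≤ (max b 16 : ℕ) := by
    exact_mod_cast max_le_max_right 16 hab
  have h1 := one_lt_log_of_sixteen_le ha
  have h1' := one_lt_log_of_sixteen_le (ha.trans hm)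
  have h2 := Real.log_pos h1
  unfold logScale
  gcongr

theorem logScale_eq {η : ℝ} {n : ℕ} (hn : 16 ≤ n) :
    logScale η n = √(Real.log n * Real.log (Real.log n) ^ (1 + η)) := by
  rw [logScale, max_eq_left hn]

theorem tendsto_logScale {η : ℝ} (hη : 0 < η) :
    Filter.Tendsto (logScale η) Filter.atTop Filter.atTop := by
  have h1 : Filter.Tendsto (fun n : ℕ => Real.log n) Filter.atTop Filter.atTop :=
    Real.tendsto_log_atTop.comp tendsto_natCast_atTop_atTop
  have h2 : Filter.Tendsto (fun n : ℕ => Real.log (Real.log n) ^ (1 + η))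
      Filter.atTop Filter.atTop :=
    (tendsto_rpow_atTop (by linarith)).comp (Real.tendsto_log_atTop.comp h1)
  refine (Real.tendsto_sqrt_atTop.comp (h1.atTop_mul_atTop₀ h2)).congr' ?_
  filter_upwards [Filter.eventually_ge_atTop 16] with n hn
  rw [logScale_eq hn]; rfl

theorem hasDerivAt_log_log_rpow_neg {η x : ℝ} (hx : 16 ≤ x) :
    HasDerivAt (fun x => Real.log (Real.log x) ^ (-η))
      (-(η * (1 / (x * (Real.log x * Real.log (Real.log x) ^ (1 + η)))))) x := by
  have h1 := one_lt_log_of_sixteen_le hx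
  have h2 := Real.log_pos h1
  have hd : HasDerivAt (fun x => Real.log (Real.log x)) (x⁻¹ / Real.log x) x :=
    (Real.hasDerivAt_log (by linarith)).log (by linarith)
  have := hd.rpow_const (p := -η) (Or.inl h2.ne')
  convert this using 1
  rw [show -η - 1 = -(1 + η) by ring, Real.rpow_neg h2.le]
  field_simp

/-- Integral test by the mean value theorem: `(log log x) ^ (-η) / η` is minus an antiderivative of
the summand, so the terms are dominated by a telescoping sum of nonnegative decreasing values. -/
theorem summable_one_div_mul_logScale_sq {η : ℝ} (hη : 0 < η) :
    Summable fun k : ℕ => 1 / (((k : ℝ) + 2) * logScale η k ^ 2) := by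
  -- After the shift, the term of index `k` is compared with the interval `[k + 16, k + 17]`, where
  -- the iterated logarithm is positive.
  rw [← summable_nat_add_iff 17]
  set f : ℝ → ℝ := fun x => Real.log (Real.log x) ^ (-η) with hf
  have hstep : ∀ x : ℝ, 16 ≤ x →
      η * (1 / ((x + 1) * (Real.log (x + 1) * Real.log (Real.log (x + 1)) ^ (1 + η)))) ≤
        f x - f (x + 1) := by
    intro x hx
    have hd : ∀ y ∈ Set.Icc x (x + 1), HasDerivAt f _ y := fun y hy =>
      hasDerivAt_log_log_rpow_neg (η := η) (hx.trans hy.1)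
    obtain ⟨y, hy, hy'⟩ := exists_hasDerivAt_eq_slope f _ (show x < x + 1 by linarith)
      (fun y hy => (hd y hy).continuousAt.continuousWithinAt)
      (fun y hy => hd y (Set.Ioo_subset_Icc_self hy))
    rw [add_sub_cancel_left, div_one] at hy'
    have h16 : 16 ≤ y := hx.trans hy.1.le
    have h1 := one_lt_log_of_sixteen_le h16
    have h2 := Real.log_pos h1
    have : f x - f (x + 1) =
      η * (1 / (y * (Real.log y * Real.log (Real.log y) ^ (1 + η)))) := by linarith
    rw [this]
    have hyx := hy.2.le
    have h3 : Real.log y ≤ Real.log (x + 1) := Real.log_le_log (by linarith) hyx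
    have h4 : 0 ≤ Real.log (x + 1) := by linarith
    gcongr
  have hfpos : ∀ x : ℝ, 16 ≤ x → 0 ≤ f x := fun x hx =>
    Real.rpow_nonneg (Real.log_pos (one_lt_log_of_sixteen_le hx)).le _
  refine (summable_of_sum_range_le (c := f 16 / η) (fun k => by positivity) fun n => ?_)
  rw [le_div_iff₀ hη, Finset.sum_mul]
  calc _ ≤ ∑ k ∈ Finset.range n, (f ((k : ℝ) + 16) - f (((k + 1 : ℕ) : ℝ) + 16)) := by
        refine Finset.sum_le_sum fun k _ => ?_
        have hk : (0 : ℝ) ≤ k := by positivity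
        have h := hstep ((k : ℝ) + 16) (by linarith)
        have hL : logScale η (k + 17) ^ 2 = Real.log ((k : ℝ) + 16 + 1) *
            Real.log (Real.log ((k : ℝ) + 16 + 1)) ^ (1 + η) := by
          have h1 := one_lt_log_of_sixteen_le (show 16 ≤ (k : ℝ) + 16 + 1 by linarith)
          have h2 := Real.log_pos h1
          rw [logScale_eq (by omega), show ((k + 17 : ℕ) : ℝ) = (k : ℝ) + 16 + 1 by
            push_cast; ring, Real.sq_sqrt (by positivity)]
        have hLpos := logScale_pos (η := η) (k + 17)
        rw [← hL] at h
        push_cast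
        rw [show (k : ℝ) + 1 + 16 = (k : ℝ) + 16 + 1 by ring]
        refine le_trans ?_ h
        rw [mul_comm]
        gcongr ?_ * (1 / (?_ * _))
        linarith
    _ = f 16 - f ((n : ℝ) + 16) := by
        rw [Finset.sum_range_sub' (fun k : ℕ => f ((k : ℝ) + 16))]; simp
    _ ≤ f 16 := by linarith [hfpos ((n : ℝ) + 16) (by linarith [(Nat.cast_nonneg n : (0 : ℝ) ≤ n)])]

/-! ### Martingale convergence. -/

/-- Weighted sums of bounded martingale differences with square-summable weights converge
almost surely. -/
theorem ae_exists_tendsto_sum_mul {Ω : Type*} {m0 : MeasurableSpace Ω} {μ : Measure Ω}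
    [IsProbabilityMeasure μ] (ℱ : Filtration ℕ m0) {ζ : ℕ → Ω → ℝ} {a : ℕ → ℝ} {K : ℝ}
    (hmeas : ∀ n, StronglyMeasurable[ℱ (n + 1)] (ζ n)) (hK : ∀ n ω, |ζ n ω| ≤ K)
    (hce : ∀ n, μ[ζ n | ℱ n] =ᵐ[μ] 0) (ha : Summable fun n => a n ^ 2) :
    ∀ᵐ ω ∂μ, ∃ l, Filter.Tendsto (fun n => ∑ k ∈ Finset.range n, a k * ζ k ω)
      Filter.atTop (nhds l) := by
  set W : ℕ → Ω → ℝ := fun n ω => ∑ k ∈ Finset.range n, a k * ζ k ω with hW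
  have hWs : ∀ n, W (n + 1) = fun ω => W n ω + a n * ζ n ω := fun n => by
    ext ω; simp [hW, Finset.sum_range_succ]
  have hWm : ∀ n, StronglyMeasurable[ℱ n] (W n) := by
    intro n
    refine Finset.stronglyMeasurable_fun_sum _ fun k hk => ?_
    exact ((hmeas k).mono (ℱ.mono (Finset.mem_range.1 hk))).const_mul (a k)
  have hζm : ∀ n, AEStronglyMeasurable (ζ n) μ := fun n =>
    ((hmeas n).mono (ℱ.le _)).aestronglyMeasurable
  have hζi : ∀ n, Integrable (ζ n) μ := fun n =>
    Integrable.of_bound (hζm n) K (Filter.Eventually.of_forall (hK n))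
  have hWb : ∀ n ω, |W n ω| ≤ ∑ k ∈ Finset.range n, |a k| * K := by
    intro n ω
    refine (Finset.abs_sum_le_sum_abs _ _).trans (Finset.sum_le_sum fun k _ => ?_)
    rw [abs_mul]
    exact mul_le_mul_of_nonneg_left (hK k ω) (abs_nonneg _)
  have hWam : ∀ n, AEStronglyMeasurable (W n) μ := fun n =>
    ((hWm n).mono (ℱ.le _)).aestronglyMeasurable
  have hWi : ∀ n, Integrable (W n) μ := fun n =>
    Integrable.of_bound (hWam n) _ (Filter.Eventually.of_forall (hWb n))
  have hWζ : ∀ n, Integrable (W n * ζ n) μ := fun n =>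
    (hζi n).bdd_mul (hWam n) (Filter.Eventually.of_forall (hWb n))
  have hWW : ∀ n, Integrable (fun ω => W n ω ^ 2) μ := fun n => by
    simpa only [pow_two] using
      (hWi n).bdd_mul (hWam n) (Filter.Eventually.of_forall (hWb n))
  have hζζ : ∀ n, Integrable (fun ω => ζ n ω ^ 2) μ := fun n => by
    simpa only [pow_two] using
      (hζi n).bdd_mul (hζm n) (Filter.Eventually.of_forall (hK n))
  have hmart : Martingale W ℱ μ := by
    refine martingale_of_condExp_sub_eq_zero_nat hWm hWi fun n => ?_
    have : W (n + 1) - W n = a n • ζ n := by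
      ext ω; simp [hWs]
    rw [this]
    filter_upwards [condExp_smul (μ := μ) (a n) (ζ n) (ℱ n), hce n] with ω h1 h2
    rw [h1]; simp [h2]
  -- Orthogonality of increments: `W n` is known at time `n` and factors out of the conditional
  -- expectation.
  have hcross : ∀ n, ∫ ω, W n ω * ζ n ω ∂μ = 0 := by
    intro n
    have h1 := condExp_mul_of_stronglyMeasurable_left (hWm n) (hWζ n) (hζi n)
    have h2 := integral_condExp (μ := μ) (f := W n * ζ n) (ℱ.le n)
    simp only [Pi.mul_apply] at h2
    rw [← h2]
    refine integral_eq_zero_of_ae ?_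
    filter_upwards [h1, hce n] with ω h1 h2
    rw [h1]; simp [h2]
  have hL2 : ∀ n, ∫ ω, W n ω ^ 2 ∂μ ≤ ∑ k ∈ Finset.range n, a k ^ 2 * K ^ 2 := by
    intro n
    induction n with
    | zero => simp [hW]
    | succ n ih =>
      have e : ∀ ω, W (n + 1) ω ^ 2 =
          W n ω ^ 2 + (2 * a n) * (W n ω * ζ n ω) + a n ^ 2 * ζ n ω ^ 2 := fun ω => by
        rw [hWs]; ring
      have i2 : Integrable (fun ω => (2 * a n) * (W n ω * ζ n ω)) μ := (hWζ n).const_mul _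
      have i3 : Integrable (fun ω => a n ^ 2 * ζ n ω ^ 2) μ := (hζζ n).const_mul _
      simp only [e]
      rw [integral_add (f := fun ω => W n ω ^ 2 + (2 * a n) * (W n ω * ζ n ω))
        ((hWW n).add i2) i3, integral_add (hWW n) i2, integral_const_mul,
        integral_const_mul, hcross, Finset.sum_range_succ]
      have : ∫ ω, ζ n ω ^ 2 ∂μ ≤ K ^ 2 := by
        have := integral_mono (hζζ n) (integrable_const (K ^ 2)) fun ω => by
          simpa using sq_le_sq' (neg_le_of_abs_le (hK n ω)) (le_of_abs_le (hK n ω))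
        simpa using this
      nlinarith [mul_le_mul_of_nonneg_left this (sq_nonneg (a n))]
  set C := (∑' k, a k ^ 2) * K ^ 2 with hC
  have hL2' : ∀ n, ∫ ω, W n ω ^ 2 ∂μ ≤ C := fun n => by
    refine (hL2 n).trans ?_
    rw [← Finset.sum_mul]
    exact mul_le_mul_of_nonneg_right (ha.sum_le_tsum _ fun i _ => sq_nonneg _) (sq_nonneg K)
  -- The convergence theorem asks for an `L¹` bound, obtained from the `L²` bound by `|w| ≤ 1 + w ^
  -- 2`.
  have hL1 : ∀ n, eLpNorm (W n) 1 μ ≤ (Real.toNNReal (1 + C) : ENNReal) := by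
    intro n
    rw [eLpNorm_one_eq_lintegral_enorm, ← ofReal_integral_norm_eq_lintegral_enorm (hWi n)]
    refine ENNReal.ofReal_le_ofReal ?_
    calc ∫ ω, ‖W n ω‖ ∂μ ≤ ∫ ω, (1 + W n ω ^ 2) ∂μ := by
          refine integral_mono (hWi n).norm ((integrable_const 1).add (hWW n)) fun ω => ?_
          simp only [Real.norm_eq_abs]
          nlinarith [sq_abs (W n ω), sq_nonneg (|W n ω| - 1)]
      _ = 1 + ∫ ω, W n ω ^ 2 ∂μ := by
          rw [integral_add (integrable_const 1) (hWW n)]; simp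
      _ ≤ 1 + C := by linarith [hL2' n]
  filter_upwards [hmart.submartingale.ae_tendsto_limitProcess hL1] with ω hω
  exact ⟨_, hω⟩

/-! ### Step directions and the mean response. -/

namespace StepSystem

variable {d : ℕ}

open Classical in
/-- All directions, as a finite set. -/
noncomputable def allDirs (L : StepSystem d) : Finset (EuclideanSpace ℝ (Fin d)) :=
  L.Vodd ∪ L.Veven

theorem mem_allDirs {L : StepSystem d} {v : EuclideanSpace ℝ (Fin d)} :
    v ∈ L.allDirs ↔ v ∈ L.V := by
  simp [allDirs, V]

theorem dirs_subset_V (L : StepSystem d) (k : ℕ) {v : EuclideanSpace ℝ (Fin d)}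
    (hv : v ∈ L.dirs k) : v ∈ L.V := by
  unfold dirs at hv
  split_ifs at hv
  exacts [Or.inl hv, Or.inr hv]

theorem exists_abs_apply_le (L : StepSystem d) :
    ∃ K : ℝ, ∀ v ∈ L.V, ∀ i, |v i| ≤ K := by
  refine ⟨∑ v ∈ L.allDirs, ‖v‖, fun v hv i => ?_⟩
  exact (PiLp.norm_apply_le v i).trans
    (Finset.single_le_sum (f := fun v => ‖v‖) (fun w _ => norm_nonneg w) (mem_allDirs.2 hv))

open Classical in
theorem Veven_eq_image (L : StepSystem d) : L.Veven = L.Vodd.image Neg.neg := by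
  ext v
  simp only [Finset.mem_image]
  constructor
  · intro hv
    exact ⟨-v, (L.mem_Vodd_iff _).2 (by simpa using hv), neg_neg v⟩
  · rintro ⟨w, hw, rfl⟩
    exact (L.mem_Vodd_iff w).1 hw

/-- The `i`-th coordinate of the barycentre of the odd directions. -/
noncomputable def bary (L : StepSystem d) (i : Fin d) : ℝ := (∑ v ∈ L.Vodd, v i) / L.m

theorem sum_dirs_apply (L : StepSystem d) (k : ℕ) (i : Fin d) :
    ∑ v ∈ L.dirs (k + 1), v i = L.m * ((-1) ^ k * L.bary i) := by
  classical
  have hm : (L.m : ℝ) ≠ 0 := by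
    have := L.two_le_card
    exact_mod_cast (show L.m ≠ 0 by unfold m; omega)
  unfold dirs bary
  by_cases hk : Even k
  · rw [if_pos hk.add_one, hk.neg_one_pow]; field_simp
  · rw [Nat.not_even_iff_odd] at hk
    rw [if_neg (by simpa using hk.add_one), hk.neg_one_pow, Veven_eq_image,
      Finset.sum_image neg_injective.injOn]
    simp only [PiLp.neg_apply, Finset.sum_neg_distrib]
    field_simp

theorem neg_mem_dirs (L : StepSystem d) {k : ℕ} {v : EuclideanSpace ℝ (Fin d)}
    (hv : v ∈ L.V) (hk : v ∉ L.dirs k) : -v ∈ L.dirs k := by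
  unfold dirs at hk ⊢
  split_ifs at hk ⊢
  · exact (L.mem_Vodd_iff _).2 (by simpa using hv.resolve_left hk)
  · exact (L.mem_Vodd_iff _).1 (hv.resolve_right hk)

/-- Since `Vodd` and `Veven` are disjoint, a direction reveals the parity of the time at which it
was used. -/
theorem mem_dirs_iff (L : StepSystem d) {j k : ℕ} {v : EuclideanSpace ℝ (Fin d)}
    (hv : v ∈ L.dirs j) : v ∈ L.dirs k ↔ (Even (j + k)) := by
  have hd := Finset.disjoint_left.1 L.disjoint_dirs
  unfold dirs at hv ⊢
  rw [Nat.even_add]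
  simp only [← Nat.not_odd_iff_even]
  split_ifs at hv ⊢ with h1 h2 h2
  · simp [h1, h2, hv]
  · simpa [h1, h2] using fun h => hd h hv
  · simpa [h1, h2] using hd hv
  · simp [h1, h2, hv]

theorem sum_ite_mul_apply {s : Finset (EuclideanSpace ℝ (Fin d))}
    {u : EuclideanSpace ℝ (Fin d)} (hu : u ∈ s) (a b : ℝ) (i : Fin d)
    [∀ w, Decidable (w = u)] :
    ∑ w ∈ s, (if w = u then a else b) * w i = b * ∑ w ∈ s, w i + (a - b) * u i := by
  have : ∀ w, (if w = u then a else b) * w i =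
      b * w i + (if w = u then (a - b) * w i else 0) := fun w => by split_ifs <;> ring
  classical
  simp only [this, Finset.sum_add_distrib, ← Finset.mul_sum]
  congr 1
  rw [Finset.sum_eq_single u]
  · simp
  · intro w _ hw; simp [hw]
  · intro h; exact absurd hu h

/-- The mean of the response at time `k + 1` to the direction used at time `j + 1`. -/
theorem sum_stepProb_mul_apply (L : StepSystem d) (p q : ℝ) (hδ : L.delta p q = 1 / 2)
    {j k : ℕ} {v : EuclideanSpace ℝ (Fin d)} (hv : v ∈ L.dirs (j + 1)) (i : Fin d) :
    ∑ w ∈ L.dirs (k + 1), L.stepProb p q (k + 1) v w * w i = (-1) ^ k * L.bary i +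
      (1 / 2 + (L.alpha p + L.beta q) / 2 * (-1) ^ k * (-1) ^ j) *
        (v i - (-1) ^ j * L.bary i) := by
  have hm : (L.m : ℝ) - 1 ≠ 0 := by
    have : (2 : ℝ) ≤ L.m := by exact_mod_cast L.two_le_card
    linarith
  have hs := L.sum_dirs_apply k i
  have hjk := L.mem_dirs_iff (k := k + 1) hv
  have hpar : Even (j + 1 + (k + 1)) ↔ Even (j + k) := by
    rw [show j + 1 + (k + 1) = j + k + 2 by ring]; simp [Nat.even_add]
  rw [hpar] at hjk
  have hjj : ((-1 : ℝ) ^ j) * (-1) ^ j = 1 := by rw [← pow_add, ← two_mul, pow_mul]; simp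
  -- This makes `1 / 2 + (α + β) / 2 * (-1) ^ k * (-1) ^ j` equal to `α` when the parities agree and
  -- to `-β` when they differ, which are the values found in the two cases below.
  have hε : L.alpha p - L.beta q = 1 := by
    have := hδ; unfold delta at this; linarith
  have ha : (L.m - 1) * L.alpha p = L.m * p - 1 := by unfold alpha; field_simp
  have hb : (L.m - 1) * L.beta q = L.m * q - 1 := by unfold beta; field_simp
  unfold stepProb
  by_cases hk : v ∈ L.dirs (k + 1)
  · have hkj : ((-1 : ℝ) ^ k) = (-1) ^ j := by
      have : ((-1 : ℝ)) ^ (j + k) = 1 := (hjk.1 hk).neg_one_pow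
      rw [pow_add] at this
      linear_combination (-1) ^ j * this - (-1) ^ k * hjj
    simp only [if_pos hk]
    rw [sum_ite_mul_apply hk, hs, hkj]
    have h1 : (1 - p) / ((L.m : ℝ) - 1) * L.m = 1 - L.alpha p := by
      rw [div_mul_eq_mul_div, div_eq_iff hm]; linear_combination ha
    have h2 : p - (1 - p) / ((L.m : ℝ) - 1) = L.alpha p := by
      rw [sub_eq_iff_eq_add, ← sub_eq_iff_eq_add', eq_div_iff hm]; linear_combination -ha
    rw [h2, ← mul_assoc, h1, mul_assoc _ ((-1 : ℝ) ^ j) ((-1 : ℝ) ^ j), hjj]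
    linear_combination (1 / 2 : ℝ) * (v i - (-1) ^ j * L.bary i) * hε
  · have hkj : ((-1 : ℝ) ^ k) = -(-1) ^ j := by
      have : ((-1 : ℝ)) ^ (j + k) = -1 :=
        (Nat.not_even_iff_odd.1 (fun h => hk (hjk.2 h))).neg_one_pow
      rw [pow_add] at this
      linear_combination (-1) ^ j * this - (-1) ^ k * hjj
    simp only [if_neg hk]
    rw [sum_ite_mul_apply (L.neg_mem_dirs (L.dirs_subset_V _ hv) hk), hs, hkj]
    have h1 : (1 - q) / ((L.m : ℝ) - 1) * L.m = 1 - L.beta q := by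
      rw [div_mul_eq_mul_div, div_eq_iff hm]; linear_combination hb
    have h2 : q - (1 - q) / ((L.m : ℝ) - 1) = L.beta q := by
      rw [sub_eq_iff_eq_add, ← sub_eq_iff_eq_add', eq_div_iff hm]; linear_combination -hb
    rw [h2, ← mul_assoc, h1, mul_neg, neg_mul _ ((-1 : ℝ) ^ j),
      mul_assoc _ ((-1 : ℝ) ^ j) ((-1 : ℝ) ^ j), hjj, PiLp.neg_apply]
    linear_combination (1 / 2 : ℝ) * (v i - (-1) ^ j * L.bary i) * hε

end StepSystem

/-! ### The filtration and the conditional mean of the next step. -/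

theorem measurableSet_comap_eq {Ω E : Type*} [m : MeasurableSpace E] [MeasurableSingletonClass E]
    (f : Ω → E) (x : E) : MeasurableSet[MeasurableSpace.comap f m] {ω | f ω = x} :=
  ⟨{x}, measurableSet_singleton x, rfl⟩

namespace IsERWInput

variable {d : ℕ} {Ω : Type*} [m0 : MeasurableSpace Ω] {L : StepSystem d} {p q : ℝ}
  {μ : Measure Ω} {X₁ : Ω → EuclideanSpace ℝ (Fin d)} {U : ℕ → Ω → ℕ}
  {G : ℕ → EuclideanSpace ℝ (Fin d) → Ω → EuclideanSpace ℝ (Fin d)}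

theorem inputSigma_le (h : IsERWInput L p q μ X₁ U G) (n : ℕ) : inputSigma L X₁ U G n ≤ m0 := by
  cases n with
  | zero => exact h.measurable_first.comap_le
  | succ n =>
    refine sup_le (h.measurable_time _ (by omega)).comap_le ?_
    exact iSup₂_le fun v hv => (h.measurable_response _ (by omega) v hv).comap_le

/-- The filtration generated by the inputs: at index `n` it knows the first `n + 1` steps. -/
def filtration (h : IsERWInput L p q μ X₁ U G) : Filtration ℕ m0 where
  seq n := ⨆ i ∈ Set.Iic n, inputSigma L X₁ U G i
  mono' _ _ hab := biSup_mono fun _ hi => hi.trans hab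
  le' _ := iSup₂_le fun i _ => h.inputSigma_le i

theorem inputSigma_le_filtration (h : IsERWInput L p q μ X₁ U G) (n : ℕ) :
    inputSigma L X₁ U G n ≤ h.filtration n :=
  le_iSup₂_of_le (f := fun i (_ : i ∈ Set.Iic n) => inputSigma L X₁ U G i) n
    Set.self_mem_Iic le_rfl

theorem indep_inputSigma_filtration (h : IsERWInput L p q μ X₁ U G) (n : ℕ) :
    Indep (inputSigma L X₁ U G (n + 1)) (h.filtration n) μ := by
  have := indep_iSup_of_disjoint h.inputSigma_le h.indep
    (S := {n + 1}) (T := Set.Iic n) (by simp)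
  rwa [iSup_singleton] at this

theorem measurableSet_time (_h : IsERWInput L p q μ X₁ U G) (n k : ℕ) :
    MeasurableSet[inputSigma L X₁ U G (n + 1)] {ω | U (n + 1) ω = k} :=
  (le_sup_left : MeasurableSpace.comap (U (n + 1)) ⊤ ≤ inputSigma L X₁ U G (n + 1)) _
    (measurableSet_comap_eq (m := ⊤) _ _)

theorem comap_response_le (_h : IsERWInput L p q μ X₁ U G) (n : ℕ)
    {v : EuclideanSpace ℝ (Fin d)} (hv : v ∈ L.V) :
    MeasurableSpace.comap (G (n + 2) v) inferInstance ≤ inputSigma L X₁ U G (n + 1) :=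
  le_sup_of_le_right (le_iSup₂_of_le v hv le_rfl)

theorem erwStep_mem (h : IsERWInput L p q μ X₁ U G) (n : ℕ) (ω : Ω) :
    erwStep X₁ U G (n + 1) ω ∈ L.dirs (n + 1) := by
  induction n using Nat.strong_induction_on with
  | _ n ih =>
    cases n with
    | zero => rw [erwStep_one]; simpa [StepSystem.dirs] using h.first_mem ω
    | succ n =>
      rw [h.erwStep_succ (n + 1) (by omega)]
      have hU := Finset.mem_Icc.1 (h.time_mem (n + 1) (by omega) ω)
      obtain ⟨j, hj⟩ : ∃ j, U (n + 1) ω = j + 1 := ⟨U (n + 1) ω - 1, by omega⟩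
      rw [hj]
      exact h.response_mem _ (by omega) _ (L.dirs_subset_V _ (ih j (by omega))) ω

/-- Splitting the next step according to the recalled time and the recalled direction. -/
theorem exists_time_eq (h : IsERWInput L p q μ X₁ U G) (n : ℕ) (ω : Ω) :
    ∃ j ∈ Finset.range (n + 1), U (n + 1) ω = j + 1 ∧
      erwStep X₁ U G (n + 2) ω = G (n + 2) (erwStep X₁ U G (j + 1) ω) ω := by
  have hU := Finset.mem_Icc.1 (h.time_mem (n + 1) (by omega) ω)
  obtain ⟨j, hj⟩ : ∃ j, U (n + 1) ω = j + 1 := ⟨U (n + 1) ω - 1, by omega⟩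
  refine ⟨j, Finset.mem_range.2 (by omega), hj, ?_⟩
  rw [h.erwStep_succ (n + 1) (by omega), hj]

/-- The response is measurable only for each fixed `v ∈ V`, so the response to a random direction is
handled by a finite union over the recalled time and the recalled direction. -/
theorem measurableSet_erwStep_eq (h : IsERWInput L p q μ X₁ U G) (n : ℕ)
    (w : EuclideanSpace ℝ (Fin d)) :
    MeasurableSet[h.filtration n] {ω | erwStep X₁ U G (n + 1) ω = w} := by
  induction n using Nat.strong_induction_on generalizing w with
  | _ n ih =>
    cases n with
    | zero =>
      simp only [zero_add, erwStep_one]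
      exact h.inputSigma_le_filtration 0 _ (measurableSet_comap_eq X₁ w)
    | succ n =>
      have : {ω | erwStep X₁ U G (n + 1 + 1) ω = w} =
          ⋃ j ∈ Finset.range (n + 1), ⋃ v ∈ L.allDirs,
            {ω | erwStep X₁ U G (j + 1) ω = v} ∩ {ω | U (n + 1) ω = j + 1} ∩
              {ω | G (n + 2) v ω = w} := by
        ext ω
        simp only [Set.mem_iUnion, Set.mem_inter_iff, Set.mem_ofPred_eq, exists_prop]
        obtain ⟨j, hj, hU, hX⟩ := h.exists_time_eq n ω
        constructor
        · intro hw
          exact ⟨j, hj, _, StepSystem.mem_allDirs.2 (L.dirs_subset_V _ (h.erwStep_mem j ω)),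
            ⟨rfl, hU⟩, hX ▸ hw⟩
        · rintro ⟨j', -, v, -, ⟨rfl, hU'⟩, hG⟩
          obtain rfl : j = j' := by omega
          exact hX.trans hG
      rw [this]
      refine Finset.measurableSet_biUnion _ fun j hj => Finset.measurableSet_biUnion _
        fun v hv => ?_
      have hj' := Finset.mem_range.1 hj
      refine ((h.filtration.mono hj'.le _ (ih j hj' v)).inter
        (h.inputSigma_le_filtration (n + 1) _ (h.measurableSet_time n (j + 1)))).inter
        (h.inputSigma_le_filtration (n + 1) _
          (h.comap_response_le n (StepSystem.mem_allDirs.1 hv) _ (measurableSet_comap_eq _ w)))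

theorem stronglyMeasurable_indicator_erwStep (h : IsERWInput L p q μ X₁ U G) (n : ℕ)
    (v : EuclideanSpace ℝ (Fin d)) :
    StronglyMeasurable[h.filtration n]
      ({ω | erwStep X₁ U G (n + 1) ω = v}.indicator fun _ => (1 : ℝ)) :=
  stronglyMeasurable_const.indicator (h.measurableSet_erwStep_eq n v)

theorem sum_indicator_erwStep (h : IsERWInput L p q μ X₁ U G) (n : ℕ) (ω : Ω)
    (f : EuclideanSpace ℝ (Fin d) → ℝ) :
    ∑ v ∈ L.allDirs, {ω | erwStep X₁ U G (n + 1) ω = v}.indicator (fun _ => (1 : ℝ)) ω * f v =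
      f (erwStep X₁ U G (n + 1) ω) := by
  rw [Finset.sum_eq_single (erwStep X₁ U G (n + 1) ω)]
  · simp
  · intro v _ hv
    rw [Set.indicator_of_notMem (by simpa using hv.symm), zero_mul]
  · intro hn
    exact absurd (StepSystem.mem_allDirs.2 (L.dirs_subset_V _ (h.erwStep_mem n ω))) hn

theorem stronglyMeasurable_erwStep_apply (h : IsERWInput L p q μ X₁ U G) (n : ℕ) (i : Fin d) :
    StronglyMeasurable[h.filtration n] fun ω => erwStep X₁ U G (n + 1) ω i := by
  have : (fun ω => erwStep X₁ U G (n + 1) ω i) = fun ω => ∑ v ∈ L.allDirs,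
      {ω | erwStep X₁ U G (n + 1) ω = v}.indicator (fun _ => (1 : ℝ)) ω * v i := by
    ext ω; exact (h.sum_indicator_erwStep n ω fun v => v i).symm
  rw [this]
  exact Finset.stronglyMeasurable_fun_sum _ fun v _ =>
    (h.stronglyMeasurable_indicator_erwStep n v).mul_const _

theorem integrable_response_apply [IsProbabilityMeasure μ] (h : IsERWInput L p q μ X₁ U G)
    (n : ℕ) {v : EuclideanSpace ℝ (Fin d)} (hv : v ∈ L.V) (i : Fin d) :
    Integrable (fun ω => G (n + 2) v ω i) μ := by
  obtain ⟨K, hK⟩ := L.exists_abs_apply_le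
  have hG := h.measurable_response (n + 2) (by omega) v hv
  refine Integrable.of_bound (by fun_prop) K (Filter.Eventually.of_forall fun ω => ?_)
  exact hK _ (L.dirs_subset_V _ (h.response_mem (n + 2) (by omega) v hv ω)) i

theorem integral_response_apply [IsProbabilityMeasure μ] (h : IsERWInput L p q μ X₁ U G)
    (n : ℕ) {v : EuclideanSpace ℝ (Fin d)} (hv : v ∈ L.V) (i : Fin d) :
    ∫ ω, G (n + 2) v ω i ∂μ = ∑ w ∈ L.dirs (n + 2), L.stepProb p q (n + 2) v w * w i := by
  have hG := h.measurable_response (n + 2) (by omega) v hv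
  have hm : ∀ w, MeasurableSet {ω | G (n + 2) v ω = w} := fun w => hG (measurableSet_singleton w)
  have e : ∀ ω, G (n + 2) v ω i =
      ∑ w ∈ L.dirs (n + 2), {ω | G (n + 2) v ω = w}.indicator (fun _ => w i) ω := by
    intro ω
    rw [Finset.sum_eq_single (G (n + 2) v ω)]
    · simp
    · intro w _ hw
      exact Set.indicator_of_notMem (by simpa using hw.symm) _
    · intro hn
      exact absurd (h.response_mem (n + 2) (by omega) v hv ω) hn
  simp only [e]
  rw [integral_finsetSum _ fun w _ => (integrable_const (w i)).indicator (hm w)]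
  refine Finset.sum_congr rfl fun w hw => ?_
  rw [integral_indicator_const _ (hm w), h.response_law (n + 2) (by omega) v hv w hw, smul_eq_mul]

theorem integral_time_mul_response [IsProbabilityMeasure μ] (h : IsERWInput L p q μ X₁ U G)
    (n : ℕ) {j : ℕ} (hj : j ∈ Finset.range (n + 1)) {v : EuclideanSpace ℝ (Fin d)}
    (hv : v ∈ L.V) (i : Fin d) :
    ∫ ω, {ω | U (n + 1) ω = j + 1}.indicator (fun _ => (1 : ℝ)) ω * G (n + 2) v ω i ∂μ =
      1 / ((n : ℝ) + 1) * ∑ w ∈ L.dirs (n + 2), L.stepProb p q (n + 2) v w * w i := by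
  have hU := h.measurable_time (n + 1) (by omega)
  have hG := h.measurable_response (n + 2) (by omega) v hv
  have hind := (h.indep_time_response (n + 1) (by omega) v hv)
  have := hind.integral_fun_comp_mul_comp (f := ({j + 1} : Set ℕ).indicator fun _ => (1 : ℝ))
    (g := fun w : EuclideanSpace ℝ (Fin d) => w i) hU.aemeasurable hG.aemeasurable
    (Measurable.of_discrete.aestronglyMeasurable) (by fun_prop)
  have e : ∀ ω, ({j + 1} : Set ℕ).indicator (fun _ => (1 : ℝ)) (U (n + 1) ω) =
      {ω | U (n + 1) ω = j + 1}.indicator (fun _ => (1 : ℝ)) ω := fun ω => rfl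
  simp only [e] at this
  have hm : MeasurableSet {ω | U (n + 1) ω = j + 1} := hU (measurableSet_singleton (j + 1))
  rw [this, h.integral_response_apply n hv i, integral_indicator_const _ hm,
    h.time_law (n + 1) (by omega) (j + 1)
    (Finset.mem_Icc.2 ⟨by omega, by have := Finset.mem_range.1 hj; omega⟩)]
  simp

/-- The step is a finite sum of products: an indicator of a past direction, known at time `n`, times
a function of the fresh inputs, independent of the past. Each product involves a single response `G
(n + 2) v`, so independence of the recalled time from each response separately is enough. -/
theorem condExp_erwStep_apply [IsProbabilityMeasure μ] (h : IsERWInput L p q μ X₁ U G)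
    (n : ℕ) (i : Fin d) :
    μ[fun ω => erwStep X₁ U G (n + 2) ω i | h.filtration n] =ᵐ[μ] fun ω =>
      ∑ j ∈ Finset.range (n + 1), 1 / ((n : ℝ) + 1) *
        ∑ w ∈ L.dirs (n + 2), L.stepProb p q (n + 2) (erwStep X₁ U G (j + 1) ω) w * w i := by
  set A : ℕ → EuclideanSpace ℝ (Fin d) → Ω → ℝ := fun j v =>
    {ω | erwStep X₁ U G (j + 1) ω = v}.indicator fun _ => (1 : ℝ) with hA
  set B : ℕ → EuclideanSpace ℝ (Fin d) → Ω → ℝ := fun j v ω =>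
    {ω | U (n + 1) ω = j + 1}.indicator (fun _ => (1 : ℝ)) ω * G (n + 2) v ω i with hB
  have hAm : ∀ j ∈ Finset.range (n + 1), ∀ v, StronglyMeasurable[h.filtration n] (A j v) :=
    fun j hj v => (h.stronglyMeasurable_indicator_erwStep j v).mono
      (h.filtration.mono (Nat.lt_succ_iff.1 (Finset.mem_range.1 hj)))
  have hBm : ∀ j, ∀ v ∈ L.V, StronglyMeasurable[inputSigma L X₁ U G (n + 1)] (B j v) := by
    intro j v hv
    refine (stronglyMeasurable_const.indicator (h.measurableSet_time n (j + 1))).mul ?_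
    have hG : Measurable[MeasurableSpace.comap (G (n + 2) v) inferInstance]
      fun ω => G (n + 2) v ω i :=
      (by fun_prop : Measurable fun w : EuclideanSpace ℝ (Fin d) => w i).comp
        (comap_measurable (G (n + 2) v))
    exact (hG.mono (h.comap_response_le n hv) le_rfl).stronglyMeasurable
  have hBi : ∀ j, ∀ v ∈ L.V, Integrable (B j v) μ := by
    intro j v hv
    refine (h.integrable_response_apply n hv i).bdd_mul (c := 1)
      ((stronglyMeasurable_const.indicator
        (h.inputSigma_le _ _ (h.measurableSet_time n (j + 1)))).aestronglyMeasurable)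
      (Filter.Eventually.of_forall fun ω => ?_)
    by_cases hω : ω ∈ {ω | U (n + 1) ω = j + 1} <;> simp [hω]
  have hABi : ∀ j ∈ Finset.range (n + 1), ∀ v ∈ L.V, Integrable (A j v * B j v) μ := by
    intro j hj v hv
    refine (hBi j v hv).bdd_mul (c := 1) ((hAm j hj v).mono (h.filtration.le n)).aestronglyMeasurable
      (Filter.Eventually.of_forall fun ω => ?_)
    by_cases hω : ω ∈ {ω | erwStep X₁ U G (j + 1) ω = v} <;> simp [hA, hω]
  -- At each `ω` only the recalled time and the direction used then contribute.
  have hsplit : (fun ω => erwStep X₁ U G (n + 2) ω i) =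
      ∑ x ∈ Finset.range (n + 1) ×ˢ L.allDirs, A x.1 x.2 * B x.1 x.2 := by
    ext ω
    rw [Finset.sum_apply, Finset.sum_product]
    obtain ⟨j, hj, hU, hX⟩ := h.exists_time_eq n ω
    simp only [Pi.mul_apply, hA, h.sum_indicator_erwStep _ ω fun v => B _ v ω]
    rw [hX, Finset.sum_eq_single_of_mem j hj]
    · simp [hB, hU]
    · intro j' _ hne
      simp only [hB]
      rw [Set.indicator_of_notMem (by simp [hU]; omega), zero_mul]
  have hterm : ∀ x ∈ Finset.range (n + 1) ×ˢ L.allDirs,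
      μ[A x.1 x.2 * B x.1 x.2 | h.filtration n] =ᵐ[μ] fun ω => A x.1 x.2 ω *
        (1 / ((n : ℝ) + 1) * ∑ w ∈ L.dirs (n + 2), L.stepProb p q (n + 2) x.2 w * w i) := by
    intro x hx
    obtain ⟨hj, hv⟩ := Finset.mem_product.1 hx
    rw [StepSystem.mem_allDirs] at hv
    filter_upwards [condExp_mul_of_stronglyMeasurable_left (hAm _ hj x.2) (hABi _ hj _ hv)
      (hBi x.1 _ hv), condExp_indep_eq (h.inputSigma_le (n + 1)) (h.filtration.le n)
      (hBm x.1 _ hv) (h.indep_inputSigma_filtration n)] with ω h1 h2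
    rw [h1, Pi.mul_apply, h2, h.integral_time_mul_response n hj hv i]
  rw [hsplit]
  have hsum := condExp_finsetSum (μ := μ) (s := Finset.range (n + 1) ×ˢ L.allDirs)
    (f := fun x => A x.1 x.2 * B x.1 x.2) (fun x hx => by
      obtain ⟨hj, hv⟩ := Finset.mem_product.1 hx
      exact hABi _ hj _ (StepSystem.mem_allDirs.1 hv)) (h.filtration n)
  have hall := (Finset.eventually_all (Finset.range (n + 1) ×ˢ L.allDirs)).2 hterm
  filter_upwards [hsum, hall] with ω h1 h2
  rw [h1, Finset.sum_apply, Finset.sum_congr rfl h2, Finset.sum_product]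
  refine Finset.sum_congr rfl fun j _ => ?_
  exact h.sum_indicator_erwStep j ω fun v =>
    1 / ((n : ℝ) + 1) * ∑ w ∈ L.dirs (n + 2), L.stepProb p q (n + 2) v w * w i

/-! ### The centred walk and the almost sure bound. -/

/-- The `i`-th coordinate of the `(n + 1)`-st step, centred by the barycentre of the admissible
directions. -/
noncomputable def centredStep (_h : IsERWInput L p q μ X₁ U G) (i : Fin d) (ω : Ω) (n : ℕ) : ℝ :=
  erwStep X₁ U G (n + 1) ω i - (-1) ^ n * L.bary i

theorem exists_abs_centredStep_le (h : IsERWInput L p q μ X₁ U G) (i : Fin d) :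
    ∃ K, ∀ ω n, |h.centredStep i ω n| ≤ K := by
  obtain ⟨K, hK⟩ := L.exists_abs_apply_le
  refine ⟨K + |L.bary i|, fun ω n => ?_⟩
  have h1 := abs_sub (erwStep X₁ U G (n + 1) ω i) ((-1) ^ n * L.bary i)
  have h2 := hK _ (L.dirs_subset_V _ (h.erwStep_mem n ω)) i
  have h3 : |(-1) ^ n * L.bary i| = |L.bary i| := by simp [abs_mul]
  unfold centredStep
  linarith

theorem stronglyMeasurable_centredStep (h : IsERWInput L p q μ X₁ U G) (i : Fin d) {n k : ℕ}
    (hkn : k ≤ n) : StronglyMeasurable[h.filtration n] fun ω => h.centredStep i ω k :=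
  ((h.stronglyMeasurable_erwStep_apply k i).mono (h.filtration.mono hkn)).sub
    stronglyMeasurable_const

theorem stronglyMeasurable_innovation_drift (h : IsERWInput L p q μ X₁ U G) (ε : ℝ) (i : Fin d)
    (n : ℕ) : StronglyMeasurable[h.filtration n] fun ω =>
      ((∑ k ∈ Finset.range (n + 1), h.centredStep i ω k) / 2 + ε * (-1) ^ (n + 1) *
        ∑ k ∈ Finset.range (n + 1), (-1) ^ k * h.centredStep i ω k) / ((n + 1 : ℕ) : ℝ) := by
  have hk : ∀ k ∈ Finset.range (n + 1),
      StronglyMeasurable[h.filtration n] fun ω => h.centredStep i ω k := fun k hk =>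
    h.stronglyMeasurable_centredStep i (Nat.lt_succ_iff.1 (Finset.mem_range.1 hk))
  have h1 := Finset.stronglyMeasurable_fun_sum _ hk
  have h2 := Finset.stronglyMeasurable_fun_sum (Finset.range (n + 1)) fun k hk' =>
    (hk k hk').const_mul ((-1 : ℝ) ^ k)
  simp only [div_eq_mul_inv]
  exact ((h1.mul_const _).add (h2.const_mul _)).mul_const _

theorem stronglyMeasurable_innovation (h : IsERWInput L p q μ X₁ U G) (ε : ℝ) (i : Fin d)
    (n : ℕ) : StronglyMeasurable[h.filtration (n + 1)] fun ω =>
      innovation ε (h.centredStep i ω) (n + 1) :=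
  (h.stronglyMeasurable_centredStep i le_rfl).sub
    ((h.stronglyMeasurable_innovation_drift ε i n).mono (h.filtration.mono n.le_succ))

/-- By `sum_stepProb_mul_apply` the mean response is affine in the recalled centred step; averaging
it over the recalled times yields exactly the drift subtracted in `innovation`. -/
theorem condExp_innovation [IsProbabilityMeasure μ] (h : IsERWInput L p q μ X₁ U G)
    (hδ : L.delta p q = 1 / 2) (i : Fin d) (n : ℕ) :
    μ[fun ω => innovation ((L.alpha p + L.beta q) / 2) (h.centredStep i ω) (n + 1) |
      h.filtration n] =ᵐ[μ] 0 := by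
  set ε := (L.alpha p + L.beta q) / 2
  set D : Ω → ℝ := fun ω => (-1) ^ (n + 1) * L.bary i +
    ((∑ k ∈ Finset.range (n + 1), h.centredStep i ω k) / 2 + ε * (-1) ^ (n + 1) *
        ∑ k ∈ Finset.range (n + 1), (-1) ^ k * h.centredStep i ω k) / ((n + 1 : ℕ) : ℝ) with hD
  have hDm : StronglyMeasurable[h.filtration n] D :=
    stronglyMeasurable_const.add (h.stronglyMeasurable_innovation_drift ε i n)
  obtain ⟨K, hK⟩ := L.exists_abs_apply_le
  have hXi : Integrable (fun ω => erwStep X₁ U G (n + 2) ω i) μ :=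
    Integrable.of_bound ((h.stronglyMeasurable_erwStep_apply (n + 1) i).mono
      (h.filtration.le _)).aestronglyMeasurable K (Filter.Eventually.of_forall fun ω =>
        hK _ (L.dirs_subset_V _ (h.erwStep_mem (n + 1) ω)) i)
  have hcond : ∀ ω, ∑ j ∈ Finset.range (n + 1), 1 / ((n : ℝ) + 1) *
      ∑ w ∈ L.dirs (n + 2), L.stepProb p q (n + 2) (erwStep X₁ U G (j + 1) ω) w * w i = D ω := by
    intro ω
    have hn : (n : ℝ) + 1 ≠ 0 := by positivity
    have e : ∀ j, ∑ w ∈ L.dirs (n + 2),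
        L.stepProb p q (n + 2) (erwStep X₁ U G (j + 1) ω) w * w i =
        (-1) ^ (n + 1) * L.bary i + (1 / 2 * h.centredStep i ω j +
          ε * (-1) ^ (n + 1) * ((-1) ^ j * h.centredStep i ω j)) := fun j => by
      rw [L.sum_stepProb_mul_apply p q hδ (k := n + 1) (h.erwStep_mem j ω) i, centredStep]
      ring
    rw [← Finset.mul_sum]
    simp only [e, Finset.sum_add_distrib, ← Finset.mul_sum, hD, Finset.sum_const,
      Finset.card_range, nsmul_eq_mul]
    push_cast
    field_simp
  -- `D` agrees almost everywhere with a conditional expectation, hence is integrable.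
  have hDi : Integrable D μ := by
    refine (integrable_condExp (m := h.filtration n)
      (f := fun ω => erwStep X₁ U G (n + 2) ω i)).congr ?_
    filter_upwards [h.condExp_erwStep_apply n i] with ω hω
    rw [hω, hcond]
  have hinn : (fun ω => innovation ε (h.centredStep i ω) (n + 1)) =
      (fun ω => erwStep X₁ U G (n + 2) ω i) - D := by
    ext ω
    simp only [innovation, centredStep, hD, Pi.sub_apply]
    ring
  rw [hinn]
  filter_upwards [condExp_sub hXi hDi (h.filtration n), h.condExp_erwStep_apply n i] with ω h1 h2
  rw [h1, Pi.sub_apply, h2, hcond, condExp_of_stronglyMeasurable (h.filtration.le n) hDm hDi]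
  simp

theorem ae_isLittleO_sum_innovation [IsProbabilityMeasure μ] (h : IsERWInput L p q μ X₁ U G)
    (hδ : L.delta p q = 1 / 2) {η : ℝ} (hη : 0 < η) (i : Fin d) :
    ∀ᵐ ω ∂μ, (fun n => ∑ k ∈ Finset.range n, innovation ((L.alpha p + L.beta q) / 2)
      (h.centredStep i ω) (k + 1) / √((k : ℝ) + 2)) =o[Filter.atTop] logScale η := by
  set ε := (L.alpha p + L.beta q) / 2
  obtain ⟨K, hK⟩ := h.exists_abs_centredStep_le i
  have hconv := ae_exists_tendsto_sum_mul (μ := μ) h.filtration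
    (ζ := fun n ω => innovation ε (h.centredStep i ω) (n + 1))
    (a := fun k => 1 / (√((k : ℝ) + 2) * logScale η k))
    (h.stronglyMeasurable_innovation ε i) (fun n ω => abs_innovation_le (hK ω) (n + 1))
    (h.condExp_innovation hδ i) ((summable_one_div_mul_logScale_sq hη).congr fun k => by
      rw [div_pow, mul_pow, Real.sq_sqrt (by positivity), one_pow])
  filter_upwards [hconv] with ω ⟨l, hl⟩
  refine (isLittleO_sum_mul_of_tendsto_sum (logScale_monotone hη) (tendsto_logScale hη) hl).congr_left
    fun n => Finset.sum_congr rfl fun k _ => ?_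
  have := (logScale_pos (η := η) k).ne'
  field_simp

/-- The centring terms alternate in sign, so at most one of them survives and centring costs only a
bounded amount. -/
theorem erwPos_apply (h : IsERWInput L p q μ X₁ U G) (n : ℕ) (ω : Ω) (i : Fin d) :
    erwPos X₁ U G n ω i = ∑ k ∈ Finset.range n, h.centredStep i ω k +
      (if Even n then 0 else 1) * L.bary i := by
  induction n with
  | zero => simp [erwPos]
  | succ n ih =>
    rw [erwPos, PiLp.add_apply, ih, Finset.sum_range_succ, centredStep]
    by_cases hn : Even n
    · simp [hn, Nat.even_add_one, hn.neg_one_pow]; ring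
    · simp [hn, Nat.even_add_one, (Nat.not_even_iff_odd.1 hn).neg_one_pow]; ring

theorem ae_isLittleO_erwPos_apply [IsProbabilityMeasure μ] (h : IsERWInput L p q μ X₁ U G)
    (hδ : L.delta p q = 1 / 2) {η : ℝ} (hη : 0 < η) (i : Fin d) :
    ∀ᵐ ω ∂μ, (fun n => erwPos X₁ U G n ω i) =o[Filter.atTop]
      fun n : ℕ => √n * logScale η n := by
  obtain ⟨K, hK⟩ := h.exists_abs_centredStep_le i
  filter_upwards [h.ae_isLittleO_sum_innovation hδ hη i] with ω hω
  set ε := (L.alpha p + L.beta q) / 2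
  obtain ⟨C, hC⟩ := exists_abs_sum_le_sqrt_mul (ε := ε) (hK ω)
  -- Passing to `n + 1` matches `hC`, which bounds the sum of the first `n + 1` terms by `√(n + 1)`.
  rw [← Filter.map_add_atTop_eq_nat 1, Asymptotics.isLittleO_map]
  set M : ℕ → ℝ := fun n => ∑ k ∈ Finset.range n,
    innovation ε (h.centredStep i ω) (k + 1) / √((k : ℝ) + 2) with hM
  have hconst : ∀ a : ℝ, (fun _ : ℕ => a) =o[Filter.atTop] logScale η := fun a =>
    Asymptotics.isLittleO_const_left.2
      (Or.inr (Filter.tendsto_abs_atTop_atTop.comp (tendsto_logScale hη)))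
  have hsucc : logScale η =O[Filter.atTop] fun n => logScale η (n + 1) :=
    Asymptotics.IsBigO.of_bound' (Filter.Eventually.of_forall fun n => by
      rw [Real.norm_of_nonneg (logScale_pos n).le, Real.norm_of_nonneg (logScale_pos _).le]
      exact logScale_monotone hη n.le_succ)
  have h1 : (fun n => |M n| + C + |L.bary i|) =o[Filter.atTop] fun n => logScale η (n + 1) :=
    ((hω.abs_left.add (hconst C)).add (hconst _)).trans_isBigO hsucc
  have h2 := (Asymptotics.isBigO_refl (fun n : ℕ => √((n + 1 : ℕ) : ℝ)) Filter.atTop).mul_isLittleO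
    h1
  refine Asymptotics.IsBigO.trans_isLittleO (Asymptotics.IsBigO.of_bound'
    (Filter.Eventually.of_forall fun n => ?_)) h2
  simp only [Function.comp_apply]
  refine le_trans ?_ (Real.le_norm_self _)
  rw [h.erwPos_apply, Real.norm_eq_abs]
  have h3 : |(if Even (n + 1) then (0 : ℝ) else 1) * L.bary i| ≤ |L.bary i| := by
    split_ifs <;> simp
  have h4 : (1 : ℝ) ≤ √((n + 1 : ℕ) : ℝ) := Real.one_le_sqrt.2 (by push_cast; linarith [(Nat.cast_nonneg n : (0 : ℝ) ≤ n)])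
  have h5 := hC n
  have h6 := abs_add_le (∑ k ∈ Finset.range (n + 1), h.centredStep i ω k)
    ((if Even (n + 1) then (0 : ℝ) else 1) * L.bary i)
  have h7 : √((n : ℝ) + 1) = √((n + 1 : ℕ) : ℝ) := by push_cast; rfl
  rw [h7] at h5
  nlinarith [mul_le_mul_of_nonneg_right h4 (abs_nonneg (L.bary i))]

end IsERWInput

theorem mainTheorem7 {d : ℕ} (L : StepSystem d) {Ω : Type*} [MeasurableSpace Ω]
    (μ : Measure Ω) [IsProbabilityMeasure μ] (p q : ℝ)
    (hp : p ∈ Set.Icc (0 : ℝ) 1) (hq : q ∈ Set.Icc (0 : ℝ) 1)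
    (X₁ : Ω → EuclideanSpace ℝ (Fin d)) (U : ℕ → Ω → ℕ)
    (G : ℕ → EuclideanSpace ℝ (Fin d) → Ω → EuclideanSpace ℝ (Fin d))
    (hERW : IsERWInput L p q μ X₁ U G) (hδ : L.delta p q = 1 / 2)
    (η : ℝ) (hη : 0 < η) :
    ∀ᵐ ω ∂μ, Asymptotics.IsLittleO Filter.atTop
      (fun n : ℕ => ‖erwPos X₁ U G n ω‖)
      (fun n : ℕ => Real.sqrt ((n : ℝ) * Real.log (n : ℝ) *
        (Real.log (Real.log (n : ℝ))) ^ (1 + η))) := by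
  filter_upwards [ae_all_iff.2 fun i => hERW.ae_isLittleO_erwPos_apply hδ hη i] with ω hω
  have hscale : (fun n : ℕ => √n * logScale η n) =ᶠ[Filter.atTop] fun n : ℕ =>
      √((n : ℝ) * Real.log n * Real.log (Real.log n) ^ (1 + η)) := by
    filter_upwards [Filter.eventually_ge_atTop 16] with n hn
    rw [logScale_eq hn, mul_assoc, Real.sqrt_mul (Nat.cast_nonneg n)]
  refine Asymptotics.IsLittleO.congr' ?_ Filter.EventuallyEq.rfl hscale
  have hsum : (fun n => ∑ i, |erwPos X₁ U G n ω i|) =o[Filter.atTop]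
      fun n : ℕ => √n * logScale η n := by
    simpa only [Finset.sum_fn] using
      Asymptotics.IsLittleO.sum (s := Finset.univ) fun i _ => (hω i).abs_left
  refine Asymptotics.IsBigO.trans_isLittleO (Asymptotics.IsBigO.of_bound'
    (Filter.Eventually.of_forall fun n => ?_)) hsum
  rw [norm_norm]
  refine le_trans ?_ (Real.le_norm_self _)
  -- The Euclidean norm is at most the sum of the absolute coordinates, so the coordinatewise bounds
  -- suffice.
  rw [EuclideanSpace.norm_eq, Real.sqrt_le_left (Finset.sum_nonneg fun i _ => abs_nonneg _)]
  simp only [Real.norm_eq_abs]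
  exact Finset.sum_sq_le_sq_sum_of_nonneg fun i _ => abs_nonneg _
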